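/- Let $S$ be a nonempty compact metric space, $C(S)$ the space of continuous real functions on $S$ with the supremum norm, $E(S)$ the set of bounded functions $f:S\to\mathbb{R}$ with only finitely many discontinuities, and $\bar E^-(S)=\{f\in E(S): f\le 0\}$. Inequalities, maxima and arithmetic operations between functions are meant pointwise. All processes have sample paths in $C(S)$. A process $\boldsymbol\vartheta=(\vartheta_s)_{s\in S}$ is max-stable if its univariate margins are non-degenerate and for every $n\ge1$ there are $a_n,b_n\in C(S)$, $a_n>0$, such that $\max_{i\le n}(\boldsymbol\vartheta^{(i)}-b_n)/a_n$ has the same distribution as $\boldsymbol\vartheta$, where $\boldsymbol\vartheta^{(1)},\boldsymbol\vartheta^{(2)},\dots$ are iid copies of $\boldsymbol\vartheta$. A standard max-stable process $\boldsymbol\eta=(\eta_s)_{s\in S}$ is a max-stable process with $P(\eta_s\le x)=e^{x}$ for all $x\le 0$ and $s\in S$. A copula process is a process $\boldsymbol U=(U_s)_{s\in S}$ whose univariate margins are uniformly distributed on $(0,1)$. It is in the max-domain of attraction of $\boldsymbol\eta$ if $n(\max_{i\le n}\boldsymbol U^{(i)}-1)$ converges to $\boldsymbol\eta$ weakly in $C(S)$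 as $n\to\infty$, where $\boldsymbol U^{(1)},\boldsymbol U^{(2)},\dots$ are iid copies of $\boldsymbol U$. A generator of the $D$-norm of $\boldsymbol\eta$ is a process $\boldsymbol Z=(Z_s)_{s\in S}$ with $\boldsymbol Z\ge 0$, $E(Z_s)=1$ for all $s\in S$, $E(\sup_{s\in S}Z_s)<\infty$ and $$P(\boldsymbol\eta\le f)=\exp\left(-\|f\|_D\right)\quad\text{for all } f\in\bar E^-(S),\qquad\text{where } \|f\|_D:=E\Big(\sup_{s\in S}|f(s)|Z_s\Big).$$ **Proposition.** Let $\boldsymbol U$ be a copula process in the max-domain of attraction of a standard max-stable process $\boldsymbol\eta$, and let $\boldsymbol Z$ be a generator of the $D$-norm of $\boldsymbol\eta$. Then, for every $f\in\bar E^-(S)$, as $n\to\infty$, $$n\Big(1-P\big(n(\boldsymbol U-1)\le f\big)\Big)\longrightarrow E\Big(\sup_{s\in S}|f(s)|Z_s\Big)=\|f\|_D$$ and $$n\,P\big(n(\boldsymbol U-1)>f\big)\longrightarrow E\Big(\inf_{s\in S}|f(s)|Z_s\Big)=:|\!|\!|f|\!|\!|_D .$$ -/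

import Mathlib

open MeasureTheory ProbabilityTheory Filter Topology

namespace FunctionalRecords

/-- The space `C(S)` of continuous real functions, with its topology of uniform convergence
(for compact `S`), carries the Borel `σ`-algebra. -/
instance instMeasurableSpaceContinuousMap {S : Type*} [TopologicalSpace S] :
    MeasurableSpace C(S, ℝ) := borel _

instance instBorelSpaceContinuousMap {S : Type*} [TopologicalSpace S] :
    BorelSpace C(S, ℝ) := ⟨rfl⟩

/-- `E(S)`: bounded real functions on `S` with only finitely many discontinuities. -/
def FunE (S : Type*) [TopologicalSpace S] : Set (S → ℝ) :=
  {f | (∃ C : ℝ, ∀ s, |f s| ≤ C) ∧ {s | ¬ ContinuousAt f s}.Finite}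

/-- `Ē⁻(S)`: the nonpositive functions of `E(S)`. -/
def FunENeg (S : Type*) [TopologicalSpace S] : Set (S → ℝ) :=
  {f | f ∈ FunE S ∧ ∀ s, f s ≤ 0}

section Processes

/- A stochastic process with continuous sample paths is a random element
`X : Ω → C(S, ℝ)` of `C(S)`; its value at the index `s` is the random variable
`fun ω => X ω s`. -/

variable {S : Type*} [TopologicalSpace S] {Ω : Type*}

/-- The pointwise maximum of the first `n + 1` iid copies of the process `X`. The iid copies are
the processes `fun ω => X (ω i)` on the sequence space `ℕ → Ω`, which is equipped with the infinite
product of the probability measure of `Ω` wherever a distribution is taken. -/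
noncomputable def iidMax (X : Ω → C(S, ℝ)) (n : ℕ) (ω : ℕ → Ω) : C(S, ℝ) :=
  (Finset.range (n + 1)).sup' Finset.nonempty_range_add_one (fun i => X (ω i))

/-- The function `(g - b) / a` for continuous `g`, `b` and continuous `a > 0`. -/
noncomputable def normalize (a b : C(S, ℝ)) (ha : ∀ s, 0 < a s) (g : C(S, ℝ)) : C(S, ℝ) where
  toFun s := (g s - b s) / a s
  continuous_toFun := (g.continuous.sub b.continuous).div a.continuous fun s => (ha s).ne'

variable [MeasurableSpace Ω]

/-- Max-stable process: non-degenerate univariate margins, and for every number `n + 1` of iid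
copies, their suitably normalized maximum has the same distribution on `C(S)` as the process. -/
def IsMaxStable (X : Ω → C(S, ℝ)) (P : Measure Ω) [IsProbabilityMeasure P] : Prop :=
  Measurable X ∧
  (∀ s, ¬ ∃ c : ℝ, ∀ᵐ ω ∂P, X ω s = c) ∧
  ∃ (a b : ℕ → C(S, ℝ)) (ha : ∀ n s, 0 < a n s), ∀ n,
    IdentDistrib (fun ω => normalize (a n) (b n) (ha n) (iidMax X n ω)) X
      (Measure.infinitePi fun _ : ℕ => P) P

/-- Standard max-stable process: max-stable, with standard negative exponential margins. -/
def IsStandardMaxStable (η : Ω → C(S, ℝ)) (P : Measure Ω) [IsProbabilityMeasure P] : Prop :=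
  IsMaxStable η P ∧ ∀ s, ∀ x : ℝ, x ≤ 0 → P.real {ω | η ω s ≤ x} = Real.exp x

/-- Copula process: continuous sample paths, margins uniformly distributed on `(0, 1)`. -/
def IsCopulaProcess (U : Ω → C(S, ℝ)) (P : Measure Ω) : Prop :=
  Measurable U ∧ ∀ s, pdf.IsUniform (fun ω => U ω s) (Set.Ioo (0 : ℝ) 1) P

/-- The copula process `U` is in the max-domain of attraction of the standard max-stable process
`η`: with `U⁽¹⁾, U⁽²⁾, …` iid copies of `U`, the processes `n (max_{i ≤ n} U⁽ⁱ⁾ - 1)` converge to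
`η` weakly in `C(S)` with the supremum norm. The sequence is indexed by `n + 1`, `n ∈ ℕ`. -/
def InMaxDomain [CompactSpace S] {Ω' : Type*} [MeasurableSpace Ω']
    (U : Ω → C(S, ℝ)) (P : Measure Ω) [IsProbabilityMeasure P]
    (η : Ω' → C(S, ℝ)) (Q : Measure Ω') [IsProbabilityMeasure Q] : Prop :=
  TendstoInDistribution (fun (n : ℕ) (ω : ℕ → Ω) => ((n : ℝ) + 1) • (iidMax U n ω - 1)) atTop η
    (fun _ => Measure.infinitePi fun _ : ℕ => P) Q

/-- A generator: continuous nonnegative sample paths, `E(Z_s) = 1` for all `s` and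
`E(sup_s Z_s) < ∞`. -/
def IsGenerator (Z : Ω → C(S, ℝ)) (P : Measure Ω) : Prop :=
  Measurable Z ∧ (∀ ω s, 0 ≤ Z ω s) ∧
  (∀ s, Integrable (fun ω => Z ω s) P ∧ ∫ ω, Z ω s ∂P = 1) ∧
  Integrable (fun ω => ⨆ s, Z ω s) P

/-- The `D`-norm generated by `Z`: `‖f‖_D = E(sup_s |f(s)| Z_s)`. -/
noncomputable def dNorm (Z : Ω → C(S, ℝ)) (P : Measure Ω) (f : S → ℝ) : ℝ :=
  ∫ ω, ⨆ s, |f s| * Z ω s ∂P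

/-- The dual `D`-norm function: `E(inf_s |f(s)| Z_s)`. -/
noncomputable def dualDNorm (Z : Ω → C(S, ℝ)) (P : Measure Ω) (f : S → ℝ) : ℝ :=
  ∫ ω, ⨅ s, |f s| * Z ω s ∂P

/-- `Z` is a generator of the `D`-norm that corresponds to the standard max-stable process `η`:
`P(η ≤ f) = exp(-‖f‖_D)` for all `f ∈ Ē⁻(S)`. -/
def IsGeneratorOf {Ω' : Type*} [MeasurableSpace Ω'] (Z : Ω → C(S, ℝ)) (P : Measure Ω)
    (η : Ω' → C(S, ℝ)) (Q : Measure Ω') : Prop :=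
  IsGenerator Z P ∧
  ∀ f ∈ FunENeg S, Q.real {ω | ∀ s, η ω s ≤ f s} = Real.exp (-dNorm Z P f)

end Processes

end FunctionalRecords

/-! By independence, `P(max ≤ f)` for `n + 1` rescaled copies is the power `P((n + 1)(U - 1) ≤ f) ^
(n + 1)`. The set `{g ≤ f}` is a continuity set of `η`, so this power tends to `exp (-‖f‖_D)`, and
taking logarithms gives the first limit (`tendsto_exists_rescale_gt`).

For the second limit, lowering a function of `Ē⁻(S)` at one point keeps it in the class and adds the
event of exceeding a level at that point. Inclusion-exclusion then gives the limit for exceedance on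
any finite set (`tendsto_forall_or_exists_rescale_gt`). Finite nets of the graph of `f` bound the
event from above by inclusion. From below, a path exceeding a slightly raised `f` on the net but not
`f` everywhere has a large increment over a short distance. If one copy does this and the others
stay below `-C`, their maximum has a large increment too; weak convergence and uniform continuity of
the paths of `η` make this rare (`eventually_mul_measureReal_largeTruncatedIncrement_lt`). -/

namespace FunctionalRecords

/-! ### Weak convergence, and passing from powers to rates. -/

section Distribution

variable {Ω' E : Type*} {Ω : ℕ → Type*} [∀ i, MeasurableSpace (Ω i)] [MeasurableSpace Ω']
  [PseudoMetricSpace E] [MeasurableSpace E] [BorelSpace E]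
  {X : (i : ℕ) → Ω i → E} {Y : Ω' → E} {P : (i : ℕ) → Measure (Ω i)}
  [∀ i, IsProbabilityMeasure (P i)] {Q : Measure Ω'} [IsProbabilityMeasure Q]

/-- Portmanteau theorem for closed sets, in terms of random elements. -/
lemma eventually_measureReal_preimage_lt (h : TendstoInDistribution X atTop Y P Q)
    {F : Set E} (hF : IsClosed F) {r : ℝ} (hr : Q.real (Y ⁻¹' F) < r) :
    ∀ᶠ n in atTop, (P n).real (X n ⁻¹' F) < r := by
  have h1 := ProbabilityMeasure.limsup_measure_closed_le_of_tendsto h.tendsto hF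
  have hr0 : 0 < r := measureReal_nonneg.trans_lt hr
  have h2 : (Q.map Y) F < ENNReal.ofReal r := by
    rw [Measure.map_apply_of_aemeasurable h.aemeasurable_limit hF.measurableSet]
    rwa [Measure.real, ← ENNReal.lt_ofReal_iff_toReal_lt (measure_ne_top _ _)] at hr
  have h3 := eventually_lt_of_limsup_lt (h1.trans_lt h2)
  filter_upwards [h3] with n hn
  have hn' : ((P n).map (X n)) F < ENNReal.ofReal r := hn
  rw [Measure.map_apply_of_aemeasurable (h.forall_aemeasurable n) hF.measurableSet] at hn'
  rwa [Measure.real, ← ENNReal.lt_ofReal_iff_toReal_lt (measure_ne_top _ _)]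

/-- Portmanteau theorem for continuity sets, in terms of random elements. -/
lemma tendsto_measureReal_preimage (h : TendstoInDistribution X atTop Y P Q)
    {F : Set E} (hF : MeasurableSet F) (h0 : Q (Y ⁻¹' frontier F) = 0) :
    Tendsto (fun n => (P n).real (X n ⁻¹' F)) atTop (𝓝 (Q.real (Y ⁻¹' F))) := by
  have h1 := ProbabilityMeasure.tendsto_measure_of_null_frontier_of_tendsto' h.tendsto (E := F)
    (by
      change (Q.map Y) _ = 0
      rwa [Measure.map_apply_of_aemeasurable h.aemeasurable_limit isClosed_frontier.measurableSet])
  have h2 : Tendsto (fun n => ((P n).map (X n)) F) atTop (𝓝 ((Q.map Y) F)) := h1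
  simp only [Measure.map_apply_of_aemeasurable h.aemeasurable_limit hF,
    fun n => Measure.map_apply_of_aemeasurable (h.forall_aemeasurable n) hF] at h2
  exact (ENNReal.tendsto_toReal (measure_ne_top _ _)).comp h2

end Distribution

/-- If `p n ^ n → exp (-c)` then `n (1 - p n) → c`. -/
lemma tendsto_mul_one_sub_of_tendsto_pow {p : ℕ → ℝ} {c : ℝ} (hp0 : ∀ n, 0 ≤ p n)
    (h : Tendsto (fun n => p n ^ (n + 1)) atTop (𝓝 (Real.exp (-c)))) :
    Tendsto (fun n : ℕ => ((n : ℝ) + 1) * (1 - p n)) atTop (𝓝 c) := by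
  have hlog : Tendsto (fun n : ℕ => -(((n : ℝ) + 1) * Real.log (p n))) atTop (𝓝 c) := by
    have h1 := ((Real.continuousAt_log (Real.exp_pos (-c)).ne').tendsto.comp h).neg
    simp only [Real.log_exp, neg_neg] at h1
    refine h1.congr fun n => ?_
    simp [Real.log_pow]
  -- Where `p n = 0`, `Real.log` returns `0` and `1 - p ≤ -log p` fails.
  have hpos : ∀ᶠ n in atTop, 0 < p n := by
    filter_upwards [h.eventually_const_lt (Real.exp_pos (-c))] with n hn
    rcases (hp0 n).eq_or_lt with h0 | h0
    · simp [← h0] at hn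
    · exact h0
  have hinv : Tendsto (fun n : ℕ => ((n : ℝ) + 1)⁻¹) atTop (𝓝 0) :=
    tendsto_inv_atTop_zero.comp
      (tendsto_atTop_add_const_right _ _ tendsto_natCast_atTop_atTop)
  have hp1 : Tendsto p atTop (𝓝 1) := by
    have h1 := (Real.continuous_exp.tendsto _).comp (hlog.neg.mul hinv)
    simp only [mul_zero, Real.exp_zero] at h1
    refine h1.congr' ?_
    filter_upwards [hpos] with n hn
    have : ((n : ℝ) + 1) ≠ 0 := by positivity
    simp only [Function.comp, neg_neg]
    rw [mul_comm, inv_mul_cancel_left₀ this, Real.exp_log hn]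
  have hlow : Tendsto (fun n : ℕ => p n * -(((n : ℝ) + 1) * Real.log (p n))) atTop (𝓝 c) := by
    simpa using hp1.mul hlog
  -- Squeeze: `-p log p ≤ 1 - p ≤ -log p`.
  refine tendsto_of_tendsto_of_tendsto_of_le_of_le' hlow hlog ?_ ?_
  · filter_upwards [hpos] with n hn
    have h1 := Real.one_sub_inv_le_log_of_pos hn
    have h2 : p n * -Real.log (p n) ≤ 1 - p n := by
      have := mul_le_mul_of_nonneg_left h1 hn.le
      rw [mul_sub, mul_inv_cancel₀ hn.ne'] at this
      linarith
    have h3 := mul_le_mul_of_nonneg_left h2 (by positivity : (0 : ℝ) ≤ (n : ℝ) + 1)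
    linarith
  · filter_upwards [hpos] with n hn
    have h1 := Real.log_le_sub_one_of_pos hn
    have h3 := mul_le_mul_of_nonneg_left h1 (by positivity : (0 : ℝ) ≤ (n : ℝ) + 1)
    linarith

/-! ### Sets of paths and closure properties of `Ē⁻(S)`. -/

section FunctionSpace

variable {S : Type*} [TopologicalSpace S]

lemma measurableSet_eval_lt (s : S) (c : ℝ) : MeasurableSet {g : C(S, ℝ) | c < g s} :=
  (isOpen_lt continuous_const (continuous_eval_const s)).measurableSet

lemma isClosed_setOf_forall_le (f : S → ℝ) : IsClosed {g : C(S, ℝ) | ∀ s, g s ≤ f s} := by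
  simp only [Set.ofPred_forall]
  exact isClosed_iInter fun s => isClosed_le (continuous_eval_const s) continuous_const

/-- The functions at which some increment over a distance less than `δ` exceeds `ε`. -/
def largeIncrement (S : Type*) [PseudoMetricSpace S] (δ ε : ℝ) : Set C(S, ℝ) :=
  {g | ∃ s t, dist s t < δ ∧ ε < g s - g t}

lemma const_mem_FunENeg {c : ℝ} (hc : c ≤ 0) : (fun _ : S => c) ∈ FunENeg S :=
  ⟨⟨⟨|c|, fun _ => le_rfl⟩, by simp [continuousAt_const]⟩, fun _ => hc⟩

lemma sub_const_mem_FunENeg {f : S → ℝ} (hf : f ∈ FunENeg S) {c : ℝ} (hc : 0 ≤ c) :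
    (fun s => f s - c) ∈ FunENeg S := by
  obtain ⟨⟨⟨C, hC⟩, hD⟩, h0⟩ := hf
  refine ⟨⟨⟨C + |c|, fun s => (abs_sub _ _).trans (by gcongr; exact hC s)⟩,
    hD.subset fun s hs h => hs (h.sub continuousAt_const)⟩, fun s => by linarith [h0 s]⟩

/-- Allowing finitely many discontinuities is what lets a condition at a single point be encoded in
a test function. -/
lemma update_mem_FunENeg [T1Space S] [DecidableEq S] {f : S → ℝ} (hf : f ∈ FunENeg S) (a : S)
    {c : ℝ} (hc : c ≤ 0) : Function.update f a c ∈ FunENeg S := by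
  obtain ⟨⟨⟨C, hC⟩, hD⟩, h0⟩ := hf
  refine ⟨⟨⟨max C |c|, fun s => ?_⟩, (hD.insert a).subset fun s hs => ?_⟩, fun s => ?_⟩
  · by_cases h : s = a
    · subst h; simp
    · simp [h, hC s]
  · by_contra hn
    simp only [Set.mem_insert_iff, Set.mem_ofPred_eq, not_or, not_not] at hn
    exact hs ((continuousAt_update_of_ne hn.1).2 hn.2)
  · by_cases h : s = a
    · subst h; simpa using hc
    · simp [h, h0 s]

end FunctionSpace

/-! ### Integrability and continuity of the `D`-norm. -/

section Generator

variable {S : Type*} [TopologicalSpace S] [CompactSpace S] {Ω : Type*} [MeasurableSpace Ω]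
  {Z : Ω → C(S, ℝ)} {P : Measure Ω} {f : S → ℝ} {C : ℝ}

lemma bddAbove_range_coe (z : C(S, ℝ)) : BddAbove (Set.range z) :=
  ⟨‖z‖, by rintro _ ⟨s, rfl⟩; exact (le_abs_self _).trans (z.norm_coe_le_norm s)⟩

lemma abs_mul_le_mul_norm (hC : ∀ s, |f s| ≤ C) (z : C(S, ℝ)) (s : S) :
    |f s| * z s ≤ C * ‖z‖ :=
  (mul_le_mul_of_nonneg_left ((le_abs_self _).trans (z.norm_coe_le_norm s)) (abs_nonneg _)).trans
    (mul_le_mul_of_nonneg_right (hC s) (norm_nonneg _))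

lemma bddAbove_range_abs_mul (hC : ∀ s, |f s| ≤ C) (z : C(S, ℝ)) :
    BddAbove (Set.range fun s => |f s| * z s) :=
  ⟨C * ‖z‖, by rintro _ ⟨s, rfl⟩; exact abs_mul_le_mul_norm hC z s⟩

/-- The supremum is uncountable, but a supremum of continuous functionals on `C(S)` is lower
semicontinuous, hence Borel. -/
lemma measurable_iSup_abs_mul (hZ : Measurable Z) (hC : ∀ s, |f s| ≤ C) :
    Measurable fun ω => ⨆ s, |f s| * Z ω s := by
  have h : LowerSemicontinuous fun z : C(S, ℝ) => ⨆ s, |f s| * z s :=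
    lowerSemicontinuous_ciSup (bddAbove_range_abs_mul hC) fun s =>
      (continuous_const.mul (continuous_eval_const s)).lowerSemicontinuous
  exact h.measurable.comp hZ

variable [Nonempty S]

lemma iSup_abs_mul_le (hC : ∀ s, |f s| ≤ C) {z : C(S, ℝ)} (hz : ∀ s, 0 ≤ z s) :
    ⨆ s, |f s| * z s ≤ C * ⨆ s, z s :=
  ciSup_le fun s => mul_le_mul (hC s) (le_ciSup (bddAbove_range_coe z) s) (hz s)
    ((abs_nonneg _).trans (hC s))

lemma IsGenerator.integrable_iSup (hZ : IsGenerator Z P) (hC : ∀ s, |f s| ≤ C) :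
    Integrable (fun ω => ⨆ s, |f s| * Z ω s) P := by
  obtain ⟨hm, h0, -, hi⟩ := hZ
  refine (hi.const_mul C).mono' (measurable_iSup_abs_mul hm hC).aestronglyMeasurable
    (.of_forall fun ω => ?_)
  rw [Real.norm_of_nonneg (Real.iSup_nonneg fun s => mul_nonneg (abs_nonneg _) (h0 ω s))]
  exact iSup_abs_mul_le hC (h0 ω)

lemma IsGenerator.dNorm_sub_const_le (hZ : IsGenerator Z P) (hC : ∀ s, |f s| ≤ C) {c : ℝ}
    (hc : 0 ≤ c) : dNorm Z P (fun s => f s - c) ≤ dNorm Z P f + c * ∫ ω, ⨆ s, Z ω s ∂P := by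
  have hC' : ∀ s, |f s - c| ≤ C + c := fun s =>
    (abs_sub _ _).trans (by rw [abs_of_nonneg hc]; gcongr; exact hC s)
  rw [dNorm, dNorm, ← integral_const_mul, ← integral_add (hZ.integrable_iSup hC)
    (hZ.2.2.2.const_mul c)]
  refine integral_mono (hZ.integrable_iSup hC') ((hZ.integrable_iSup hC).add
    (hZ.2.2.2.const_mul c)) fun ω => ciSup_le fun s => ?_
  have h1 := le_ciSup (bddAbove_range_abs_mul hC (Z ω)) s
  have h2 := mul_le_mul_of_nonneg_left (le_ciSup (bddAbove_range_coe (Z ω)) s) hc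
  have h3 := mul_le_mul_of_nonneg_right (abs_sub (f s) c) (hZ.2.1 ω s)
  rw [abs_of_nonneg hc, add_mul] at h3
  exact h3.trans (add_le_add h1 h2)

end Generator

/-! ### Maxima of independent copies. -/

section Maxima

variable {S : Type*} [TopologicalSpace S] {Ω : Type*} {U X : Ω → C(S, ℝ)}

lemma iidMax_apply (X : Ω → C(S, ℝ)) (n : ℕ) (ω : ℕ → Ω) (s : S) :
    iidMax X n ω s = (Finset.range (n + 1)).sup' Finset.nonempty_range_add_one
      (fun i => X (ω i) s) := by
  rw [iidMax, ContinuousMap.sup'_apply]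

lemma iidMax_le_iff {n : ℕ} {ω : ℕ → Ω} {s : S} {c : ℝ} :
    iidMax X n ω s ≤ c ↔ ∀ i ∈ Finset.range (n + 1), X (ω i) s ≤ c := by
  rw [iidMax_apply, Finset.sup'_le_iff]

lemma le_iidMax {n i : ℕ} (hi : i ∈ Finset.range (n + 1)) (ω : ℕ → Ω) (s : S) :
    X (ω i) s ≤ iidMax X n ω s :=
  iidMax_le_iff.1 le_rfl i hi

/-- The rescaled process `(n + 1) (U - 1)`. -/
noncomputable def rescale (U : Ω → C(S, ℝ)) (n : ℕ) (ω : Ω) : C(S, ℝ) :=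
  ((n : ℝ) + 1) • (U ω - 1)

lemma rescale_apply (U : Ω → C(S, ℝ)) (n : ℕ) (ω : Ω) (s : S) :
    rescale U n ω s = ((n : ℝ) + 1) * (U ω s - 1) := by simp [rescale]

lemma smul_iidMax_sub_one (U : Ω → C(S, ℝ)) (n : ℕ) (ω : ℕ → Ω) :
    ((n : ℝ) + 1) • (iidMax U n ω - 1) = iidMax (rescale U n) n ω := by
  have hn : (0 : ℝ) < (n : ℝ) + 1 := by positivity
  ext s
  refine le_antisymm ?_ (iidMax_le_iff.2 fun i hi => ?_)
  · obtain ⟨i, hi, h⟩ := Finset.exists_mem_eq_sup' (Finset.nonempty_range_add_one (n := n))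
      (fun i => U (ω i) s)
    have h2 := le_iidMax (X := rescale U n) hi ω s
    rw [rescale_apply, ← h, ← iidMax_apply] at h2
    simpa using h2
  · rw [rescale_apply]
    have := le_iidMax (X := U) hi ω s
    simp only [ContinuousMap.smul_apply, ContinuousMap.sub_apply, ContinuousMap.one_apply,
      smul_eq_mul]
    gcongr

variable [MeasurableSpace Ω] {P : Measure Ω} [IsProbabilityMeasure P]

lemma measurable_rescale [CompactSpace S] (hU : Measurable U) (n : ℕ) :
    Measurable (rescale U n) := by
  have : Continuous fun g : C(S, ℝ) => ((n : ℝ) + 1) • (g - 1) := by fun_prop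
  exact this.measurable.comp hU

lemma measureReal_infinitePi_pi {s : Finset ℕ} {t : ℕ → Set Ω}
    (ht : ∀ i ∈ s, MeasurableSet (t i)) :
    (Measure.infinitePi fun _ : ℕ => P).real (Set.pi s t) = ∏ i ∈ s, P.real (t i) := by
  rw [Measure.real, Measure.infinitePi_pi _ ht, ENNReal.toReal_prod]
  rfl

lemma measureReal_iidMax_le (hX : Measurable X) (n : ℕ) (f : S → ℝ) :
    (Measure.infinitePi fun _ : ℕ => P).real {ω | ∀ s, iidMax X n ω s ≤ f s} =
      P.real {ω | ∀ s, X ω s ≤ f s} ^ (n + 1) := by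
  have h : {ω : ℕ → Ω | ∀ s, iidMax X n ω s ≤ f s} =
      Set.pi (Finset.range (n + 1)) fun _ => {ω | ∀ s, X ω s ≤ f s} := by
    ext ω
    simp only [iidMax_le_iff, Set.mem_ofPred_eq, Set.mem_pi, Finset.mem_coe]
    exact ⟨fun h i hi s => h s i hi, fun h s i hi => h i hi s⟩
  have hm : MeasurableSet {ω | ∀ s, X ω s ≤ f s} :=
    hX (isClosed_setOf_forall_le f).measurableSet
  rw [h, measureReal_infinitePi_pi fun _ _ => hm]
  simp

end Maxima

/-! ### The limit for the `D`-norm. -/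

section SupNorm

variable {S : Type*} [TopologicalSpace S] [CompactSpace S]
  {Ω₁ Ω₂ Ω₃ : Type*} [MeasurableSpace Ω₁] [MeasurableSpace Ω₂] [MeasurableSpace Ω₃]
  {P₁ : Measure Ω₁} [IsProbabilityMeasure P₁] {P₂ : Measure Ω₂} [IsProbabilityMeasure P₂]
  {P₃ : Measure Ω₃} {U : Ω₁ → C(S, ℝ)} {η : Ω₂ → C(S, ℝ)} {Z : Ω₃ → C(S, ℝ)} {f : S → ℝ}

lemma InMaxDomain.tendsto_iidMax_rescale (h : InMaxDomain U P₁ η P₂) :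
    TendstoInDistribution (fun n => iidMax (rescale U n) n) atTop η
      (fun _ => Measure.infinitePi fun _ : ℕ => P₁) P₂ := by
  have h' := h
  unfold InMaxDomain at h'
  simpa only [smul_iidMax_sub_one] using h'

lemma forall_le_sub_subset_interior (f : S → ℝ) {c : ℝ} (hc : 0 < c) :
    {g : C(S, ℝ) | ∀ s, g s ≤ f s - c} ⊆ interior {g : C(S, ℝ) | ∀ s, g s ≤ f s} := by
  intro g hg
  refine mem_interior_iff_mem_nhds.2 (Filter.mem_of_superset (Metric.ball_mem_nhds g hc) ?_)
  intro g' hg' s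
  have h1 := hg s
  have h2 := (abs_le.1 ((ContinuousMap.dist_le hc.le).1 (Metric.mem_ball.1 hg').le s)).2
  linarith

lemma measurableSet_exists_rescale_gt (hU : Measurable U) (n : ℕ) (f : S → ℝ) :
    MeasurableSet {ω | ∃ s, f s < rescale U n ω s} := by
  have h : {ω | ∃ s, f s < rescale U n ω s} =
      (rescale U n ⁻¹' {g | ∀ s, g s ≤ f s})ᶜ := by
    ext ω; simp
  rw [h]
  exact (measurable_rescale hU n (isClosed_setOf_forall_le f).measurableSet).compl

variable [Nonempty S]

/-- The boundary lies in `{g ≤ f}` minus `{g ≤ f - c}` for every `c > 0`. The mass of this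
difference is explicit and vanishes as `c → 0`, because the `D`-norm grows at most linearly in `c`.
-/
lemma IsGeneratorOf.frontier_null (hZ : IsGeneratorOf Z P₃ η P₂) (hη : Measurable η)
    (hf : f ∈ FunENeg S) :
    P₂ (η ⁻¹' frontier {g : C(S, ℝ) | ∀ s, g s ≤ f s}) = 0 := by
  set F : Set C(S, ℝ) := {g | ∀ s, g s ≤ f s} with hF
  obtain ⟨C, hC⟩ := hf.1.1
  set m := ∫ ω, ⨆ s, Z ω s ∂P₃
  have key : ∀ c > 0, P₂.real (η ⁻¹' frontier F) ≤
      Real.exp (-dNorm Z P₃ f) - Real.exp (-(dNorm Z P₃ f + c * m)) := by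
    intro c hc
    have h1 : η ⁻¹' frontier F ⊆ η ⁻¹' F \ η ⁻¹' {g | ∀ s, g s ≤ f s - c} := by
      rw [(isClosed_setOf_forall_le f).frontier_eq, ← Set.preimage_sdiff]
      exact Set.preimage_mono (Set.sdiff_subset_sdiff_right (forall_le_sub_subset_interior f hc))
    refine (measureReal_mono h1).trans ?_
    rw [measureReal_sdiff (fun ω h s => (h s).trans (by linarith))
      (hη (isClosed_setOf_forall_le fun s => f s - c).measurableSet)]
    have h2 : P₂.real (η ⁻¹' F) = _ := hZ.2 f hf
    have h3 : P₂.real (η ⁻¹' {g | ∀ s, g s ≤ f s - c}) = _ :=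
      hZ.2 _ (sub_const_mem_FunENeg hf hc.le)
    rw [h2, h3]
    gcongr
    exact hZ.1.dNorm_sub_const_le hC hc.le
  have hlim : Tendsto (fun c : ℝ => Real.exp (-dNorm Z P₃ f) -
      Real.exp (-(dNorm Z P₃ f + c * m))) (𝓝[>] 0) (𝓝 0) := by
    have : Continuous fun c : ℝ => Real.exp (-dNorm Z P₃ f) -
      Real.exp (-(dNorm Z P₃ f + c * m)) := by fun_prop
    have h := this.tendsto 0
    simp only [zero_mul, add_zero, sub_self] at h
    exact h.mono_left nhdsWithin_le_nhds
  have h0 := ge_of_tendsto hlim (eventually_mem_nhdsWithin.mono key)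
  exact (measureReal_eq_zero_iff).1 (le_antisymm h0 measureReal_nonneg)

lemma tendsto_pow_measureReal_rescale_le (hU : Measurable U) (hη : Measurable η)
    (hUη : InMaxDomain U P₁ η P₂) (hZ : IsGeneratorOf Z P₃ η P₂) (hf : f ∈ FunENeg S) :
    Tendsto (fun n : ℕ => P₁.real {ω | ∀ s, rescale U n ω s ≤ f s} ^ (n + 1)) atTop
      (𝓝 (Real.exp (-dNorm Z P₃ f))) := by
  have h := tendsto_measureReal_preimage hUη.tendsto_iidMax_rescale
    (isClosed_setOf_forall_le f).measurableSet (hZ.frontier_null hη hf)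
  rw [← hZ.2 f hf]
  exact h.congr fun n => measureReal_iidMax_le (measurable_rescale hU n) n f

lemma tendsto_exists_rescale_gt (hU : Measurable U) (hη : Measurable η)
    (hUη : InMaxDomain U P₁ η P₂) (hZ : IsGeneratorOf Z P₃ η P₂) (hf : f ∈ FunENeg S) :
    Tendsto (fun n : ℕ => ((n : ℝ) + 1) * P₁.real {ω | ∃ s, f s < rescale U n ω s}) atTop
      (𝓝 (dNorm Z P₃ f)) := by
  refine (tendsto_mul_one_sub_of_tendsto_pow (fun n => measureReal_nonneg)
    (tendsto_pow_measureReal_rescale_le hU hη hUη hZ hf)).congr fun n => ?_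
  have hm : MeasurableSet {ω | ∀ s, rescale U n ω s ≤ f s} :=
    measurable_rescale hU n (isClosed_setOf_forall_le f).measurableSet
  rw [← probReal_compl_eq_one_sub hm]
  congr 2
  ext ω; simp

end SupNorm

/-! ### Modification at one point; almost sure bounds. -/

section Points

variable {S : Type*} [TopologicalSpace S] {Ω : Type*} {U Z : Ω → C(S, ℝ)} {g : S → ℝ}

lemma exists_update_min_lt_iff [DecidableEq S] {a : S} {x : C(S, ℝ)} {c : ℝ} :
    (∃ s, Function.update g a (min (g a) c) s < x s) ↔ c < x a ∨ ∃ s, g s < x s := by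
  constructor
  · rintro ⟨s, hs⟩
    by_cases hsa : s = a
    · subst hsa
      rw [Function.update_self, min_lt_iff] at hs
      exact hs.symm.imp_right fun h => ⟨s, h⟩
    · exact Or.inr ⟨s, by simpa [hsa] using hs⟩
  · rintro (h | ⟨s, hs⟩)
    · exact ⟨a, by simp [h]⟩
    · refine ⟨s, lt_of_le_of_lt ?_ hs⟩
      by_cases hsa : s = a
      · subst hsa; simp
      · simp [hsa]

lemma rescale_nonpos {n : ℕ} {ω : Ω} (h : ∀ s, U ω s ≤ 1) (s : S) : rescale U n ω s ≤ 0 := by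
  rw [rescale_apply]
  exact mul_nonpos_of_nonneg_of_nonpos (by positivity) (by linarith [h s])

variable [MeasurableSpace Ω] {P : Measure Ω}

lemma IsGenerator.integrable_inf' (hZ : IsGenerator Z P) {T : Finset S} (hT : T.Nonempty)
    (h : S → ℝ) : Integrable (fun ω => T.inf' hT fun t => |h t| * Z ω t) P := by
  induction hT using Finset.Nonempty.cons_induction with
  | singleton a => simpa using (hZ.2.2.1 a).1.const_mul _
  | cons a T ha hT ih =>
    simp only [Finset.inf'_cons hT]
    exact ((hZ.2.2.1 a).1.const_mul _).inf ih

/-- The exceptional null set depends on `s`; a countable dense set and path continuity make it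
uniform. -/
lemma IsCopulaProcess.ae_le_one [TopologicalSpace.SeparableSpace S] (hU : IsCopulaProcess U P) : ∀ᵐ ω ∂P, ∀ s, U ω s ≤ 1 := by
  cases isEmpty_or_nonempty S
  · exact .of_forall fun ω s => isEmptyElim s
  have h1 : ∀ s, ∀ᵐ ω ∂P, U ω s ≤ 1 := by
    intro s
    have hm : Measurable fun ω => U ω s := (continuous_eval_const s).measurable.comp hU.1
    have h2 : ∀ᵐ x ∂(P.map fun ω => U ω s), x ∈ Set.Ioo (0 : ℝ) 1 := by
      rw [hU.2 s]
      exact ae_cond_mem measurableSet_Ioo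
    filter_upwards [ae_of_ae_map hm.aemeasurable h2] with ω hω using hω.2.le
  filter_upwards [ae_all_iff.2 fun i => h1 (TopologicalSpace.denseSeq S i)] with ω hω s
  exact (TopologicalSpace.denseRange_denseSeq S).induction_on s
    (isClosed_le (U ω).continuous continuous_const) hω

end Points

/-! ### Joint exceedance on finite sets. -/

section FiniteDimensional

variable {S : Type*} [MetricSpace S] [CompactSpace S]
  {Ω₁ Ω₂ Ω₃ : Type*} [MeasurableSpace Ω₁] [MeasurableSpace Ω₂] [MeasurableSpace Ω₃]
  {P₁ : Measure Ω₁} [IsProbabilityMeasure P₁] {P₂ : Measure Ω₂} [IsProbabilityMeasure P₂]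
  {P₃ : Measure Ω₃} {U : Ω₁ → C(S, ℝ)} {η : Ω₂ → C(S, ℝ)} {Z : Ω₃ → C(S, ℝ)} {f g h : S → ℝ}

/-- Counterpart in the limit of `exists_update_min_lt_iff`: a union of events corresponds to a
maximum. -/
lemma iSup_abs_update_mul [DecidableEq S] [Nonempty S] {C : ℝ} (hC : ∀ s, |g s| ≤ C)
    (hg : ∀ s, g s ≤ 0) (a : S) {c : ℝ} (hc : c ≤ 0) {z : C(S, ℝ)} (hz : ∀ s, 0 ≤ z s) :
    ⨆ s, |Function.update g a (min (g a) c) s| * z s =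
      max (|c| * z a) (⨆ s, |g s| * z s) := by
  have hle : ∀ s, |Function.update g a (min (g a) c) s| * z s ≤
      max (|c| * z a) (⨆ s, |g s| * z s) := by
    intro s
    have h1 := le_ciSup (bddAbove_range_abs_mul hC z) s
    by_cases hsa : s = a
    · subst hsa
      rw [Function.update_self]
      rcases min_choice (g s) c with h | h <;> rw [h]
      · exact le_max_of_le_right h1
      · exact le_max_left _ _
    · rw [Function.update_of_ne hsa]
      exact le_max_of_le_right h1
  have hbdd : BddAbove (Set.range fun s => |Function.update g a (min (g a) c) s| * z s) :=
    ⟨_, by rintro _ ⟨s, rfl⟩; exact hle s⟩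
  refine le_antisymm (ciSup_le hle) (max_le ?_ (ciSup_mono hbdd fun s => ?_))
  · refine le_trans ?_ (le_ciSup hbdd a)
    rw [Function.update_self]
    refine mul_le_mul_of_nonneg_right ?_ (hz a)
    rw [abs_of_nonpos hc, abs_of_nonpos (min_le_of_left_le (hg a))]
    exact neg_le_neg (min_le_right _ _)
  · refine mul_le_mul_of_nonneg_right ?_ (hz s)
    by_cases hsa : s = a
    · subst hsa
      rw [Function.update_self, abs_of_nonpos (hg s), abs_of_nonpos (min_le_of_left_le (hg s))]
      exact neg_le_neg (min_le_left _ _)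
    · rw [Function.update_of_ne hsa]

/-- The extra alternative involving `g` makes the induction on `T` close: inclusion-exclusion for a
new point `a` produces a union, which is absorbed by lowering `g` at `a`. -/
lemma tendsto_forall_or_exists_rescale_gt [Nonempty S] (hU : Measurable U) (hη : Measurable η)
    (hUη : InMaxDomain U P₁ η P₂) (hZ : IsGeneratorOf Z P₃ η P₂) (hh : ∀ s, h s ≤ 0)
    {T : Finset S} (hT : T.Nonempty) (hg : g ∈ FunENeg S) :
    Tendsto (fun n : ℕ => ((n : ℝ) + 1) *
        P₁.real {ω | (∀ t ∈ T, h t < rescale U n ω t) ∨ ∃ s, g s < rescale U n ω s}) atTop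
      (𝓝 (∫ ω, max (T.inf' hT fun t => |h t| * Z ω t) (⨆ s, |g s| * Z ω s) ∂P₃)) := by
  classical
  have hZ0 := hZ.1.2.1
  have hupd : ∀ {g : S → ℝ}, g ∈ FunENeg S → ∀ a,
      Function.update g a (min (g a) (h a)) ∈ FunENeg S :=
    fun hg a => update_mem_FunENeg hg a (min_le_of_right_le (hh a))
  induction hT using Finset.Nonempty.cons_induction generalizing g with
  | singleton a =>
    obtain ⟨C, hC⟩ := hg.1.1
    have h1 := tendsto_exists_rescale_gt hU hη hUη hZ (hupd hg a)
    simp only [exists_update_min_lt_iff, dNorm] at h1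
    simp only [iSup_abs_update_mul hC hg.2 a (hh a) (hZ0 _)] at h1
    simpa using h1
  | cons a T ha hT ih =>
    obtain ⟨C, hC⟩ := hg.1.1
    have h1 := tendsto_exists_rescale_gt hU hη hUη hZ (hupd hg a)
    -- `P(E ∩ F) = P(F) + P(E) - P(E ∪ F)`, where `E` is the event for `T` and `g`, and `F` is
    -- exceeding the lowered `g` somewhere.
    have h2 := (h1.add (ih hg)).sub (ih (hupd hg a))
    obtain ⟨C', hC'⟩ := (hupd hg a).1.1
    have i1 := hZ.1.integrable_iSup hC'
    have i2 := (hZ.1.integrable_inf' hT h).sup (hZ.1.integrable_iSup hC)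
    have i3 := (hZ.1.integrable_inf' hT h).sup i1
    convert h2 using 2 with n
    · rw [← mul_add, ← mul_sub]
      congr 1
      have hm := measurableSet_exists_rescale_gt (U := U) hU n
        (Function.update g a (min (g a) (h a)))
      have h3 := measureReal_union_add_inter (μ := P₁)
        (s := {ω | (∀ t ∈ T, h t < rescale U n ω t) ∨ ∃ s, g s < rescale U n ω s}) hm
      rw [show {ω | (∀ t ∈ Finset.cons a T ha, h t < rescale U n ω t) ∨
          ∃ s, g s < rescale U n ω s} = {ω | (∀ t ∈ T, h t < rescale U n ω t) ∨
          ∃ s, g s < rescale U n ω s} ∩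
          {ω | ∃ s, Function.update g a (min (g a) (h a)) s < rescale U n ω s} from ?_,
        show {ω | (∀ t ∈ T, h t < rescale U n ω t) ∨
          ∃ s, Function.update g a (min (g a) (h a)) s < rescale U n ω s} =
          {ω | (∀ t ∈ T, h t < rescale U n ω t) ∨ ∃ s, g s < rescale U n ω s} ∪
          {ω | ∃ s, Function.update g a (min (g a) (h a)) s < rescale U n ω s} from ?_]
      · linarith
      · ext ω
        simp only [exists_update_min_lt_iff, Set.mem_ofPred_eq, Set.mem_union]
        tauto
      · ext ω
        simp only [exists_update_min_lt_iff, Set.mem_ofPred_eq, Set.mem_inter_iff,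
          Finset.forall_mem_cons]
        tauto
    · refine Eq.trans ?_ ((integral_sub (i1.add i2) i3).trans
        (congrArg (· - _) (integral_add i1 i2)))
      refine integral_congr_ae (.of_forall fun ω => ?_)
      simp only [Pi.add_apply, Pi.sup_apply, Finset.inf'_cons hT,
        iSup_abs_update_mul hC hg.2 a (hh a) (hZ0 ω)]
      generalize |h a| * Z ω a = x
      generalize (T.inf' hT fun t => |h t| * Z ω t) = m
      generalize (⨆ s, |g s| * Z ω s) = M
      -- The same identity for maxima: `max (min x m) M = max x M + max m M - max m (max x M)`.
      grind

lemma tendsto_forall_mem_rescale_gt [Nonempty S] (hU : IsCopulaProcess U P₁) (hη : Measurable η)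
    (hUη : InMaxDomain U P₁ η P₂) (hZ : IsGeneratorOf Z P₃ η P₂) (hh : ∀ s, h s ≤ 0)
    {T : Finset S} (hT : T.Nonempty) :
    Tendsto (fun n : ℕ => ((n : ℝ) + 1) * P₁.real {ω | ∀ t ∈ T, h t < rescale U n ω t}) atTop
      (𝓝 (∫ ω, T.inf' hT fun t => |h t| * Z ω t ∂P₃)) := by
  -- With `g = 0` the alternative is a null event, since `U ≤ 1` almost surely.
  have h1 := tendsto_forall_or_exists_rescale_gt hU.1 hη hUη hZ hh hT
    (const_mem_FunENeg (S := S) le_rfl)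
  convert h1 using 2 with n
  · congr 1
    refine measureReal_congr ?_
    filter_upwards [hU.ae_le_one] with ω hω
    refine propext (Iff.symm (or_iff_left ?_))
    rintro ⟨s, hs⟩
    exact hs.not_ge (rescale_nonpos hω s)
  · refine integral_congr_ae (.of_forall fun ω => ?_)
    simp only [abs_zero, zero_mul, ciSup_const]
    exact (max_eq_left (Finset.le_inf' _ _ fun t _ =>
      mul_nonneg (abs_nonneg _) (hZ.1.2.1 ω t))).symm

end FiniteDimensional

/-! ### Approximation of infima by finite nets. -/

section Nets

variable {S : Type*} [MetricSpace S] [CompactSpace S] [Nonempty S] {f : S → ℝ} {C : ℝ}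

/-- A bounded function on a compact space has finite nets for its graph. -/
lemma exists_finset_graph_net (hC : ∀ s, |f s| ≤ C) {δ : ℝ} (hδ : 0 < δ) :
    ∃ T : Finset S, T.Nonempty ∧ ∀ s, ∃ t ∈ T, dist s t < δ ∧ |f s - f t| < δ := by
  classical
  -- A net of `S` alone would miss jumps of `f`; the graph sits in the compact set `S × [-C, C]`.
  have hb : TotallyBounded (Set.range fun s => (s, f s)) := by
    refine (isCompact_univ.prod (isCompact_Icc (a := -C) (b := C))).totallyBounded.subset ?_
    rintro _ ⟨s, rfl⟩
    exact ⟨trivial, abs_le.1 (hC s)⟩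
  obtain ⟨t, hts, htf, hcov⟩ := Metric.finite_approx_of_totallyBounded hb δ hδ
  have key : ∀ s, ∃ u ∈ htf.toFinset.image Prod.fst, dist s u < δ ∧ |f s - f u| < δ := by
    intro s
    obtain ⟨y, hy, hsy⟩ := Set.mem_iUnion₂.1 (hcov ⟨s, rfl⟩)
    obtain ⟨u, rfl⟩ := hts hy
    have h := max_lt_iff.1 (Prod.dist_eq.symm.trans_lt (Metric.mem_ball.1 hsy))
    exact ⟨u, Finset.mem_image.2 ⟨_, htf.mem_toFinset.2 hy, rfl⟩, h.1, by
      simpa [Real.dist_eq] using h.2⟩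
  obtain ⟨u, hu, -⟩ := key (Classical.arbitrary S)
  exact ⟨_, ⟨u, hu⟩, key⟩

variable {T : ℕ → Finset S} {ε : ℕ → ℝ} {h : ℕ → S → ℝ}

lemma tendsto_inf'_abs_mul (hC : ∀ s, |f s| ≤ C) (hT : ∀ k, (T k).Nonempty)
    (hε : Tendsto ε atTop (𝓝 0))
    (hnet : ∀ k s, ∃ t ∈ T k, dist s t < ε k ∧ |f s - f t| < ε k)
    (hh : ∀ k s, |h k s - f s| ≤ 2 * ε k) {z : C(S, ℝ)} (hz : ∀ s, 0 ≤ z s) :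
    Tendsto (fun k => (T k).inf' (hT k) fun t => |h k t| * z t) atTop
      (𝓝 (⨅ s, |f s| * z s)) := by
  have hC0 : 0 ≤ C := (abs_nonneg _).trans (hC (Classical.arbitrary S))
  have hbdd : BddBelow (Set.range fun s => |f s| * z s) :=
    ⟨0, by rintro _ ⟨s, rfl⟩; exact mul_nonneg (abs_nonneg _) (hz s)⟩
  have hzn : ∀ s, z s ≤ ‖z‖ := fun s => (le_abs_self _).trans (z.norm_coe_le_norm s)
  have hclose : ∀ k s, |h k s| * z s ≤ |f s| * z s + 2 * ε k * ‖z‖ ∧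
      |f s| * z s ≤ |h k s| * z s + 2 * ε k * ‖z‖ := by
    intro k s
    have h0 := hh k s
    have h1 := abs_le.1 ((abs_abs_sub_abs_le_abs_sub (h k s) (f s)).trans h0)
    have h2 := mul_le_mul h0 (hzn s) (hz s) ((abs_nonneg _).trans h0)
    have h3 : 2 * ε k * z s ≤ 2 * ε k * ‖z‖ :=
      mul_le_mul_of_nonneg_left (hzn s) ((abs_nonneg _).trans h0)
    constructor <;> nlinarith [hz s]
  -- Two `ε k` pay for replacing `h k` by `f`, one for moving `f` from `s` to a net point.
  have hlim : Tendsto (fun k => 3 * ε k * ‖z‖) atTop (𝓝 0) := by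
    simpa using (hε.const_mul 3).mul_const ‖z‖
  rw [Metric.tendsto_nhds]
  intro τ hτ
  -- `C + 1` keeps the denominator positive when `C = 0`.
  have hτ' : 0 < τ / (3 * (C + 1)) := by positivity
  obtain ⟨δ, hδ, huc⟩ := Metric.uniformContinuous_iff.1
    (CompactSpace.uniformContinuous_of_continuous z.continuous) _ hτ'
  filter_upwards [hε.eventually_lt_const hδ, hlim.eventually_lt_const (by positivity : 0 < τ / 3)]
    with k hk1 hk2
  have hεk : 0 ≤ ε k := by
    obtain ⟨t, -, ht, -⟩ := hnet k (Classical.arbitrary S)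
    exact dist_nonneg.trans ht.le
  have hεz : 0 ≤ ε k * ‖z‖ := mul_nonneg hεk (norm_nonneg z)
  rw [Real.dist_eq, abs_lt]
  constructor
  · obtain ⟨t, -, ht⟩ := Finset.exists_mem_eq_inf' (hT k) fun t => |h k t| * z t
    rw [ht]
    linarith [(hclose k t).2, ciInf_le hbdd t]
  · obtain ⟨s, hs⟩ := exists_lt_of_ciInf_lt
      (lt_add_of_pos_right (⨅ s, |f s| * z s) (by positivity : 0 < τ / 3))
    obtain ⟨t, htT, hst, hf⟩ := hnet k s
    have h1 := Finset.inf'_le (fun t => |h k t| * z t) htT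
    have h2 : |f t| * z t ≤ |f s| * z t + ε k * ‖z‖ := by
      have h3 := (abs_le.1 ((abs_abs_sub_abs_le_abs_sub (f s) (f t)).trans hf.le)).1
      have h4 := mul_le_mul_of_nonneg_left (hzn t) hεk
      nlinarith [hz t]
    have h5 : |f s| * z t ≤ |f s| * z s + τ / 3 := by
      have h6 := huc (hst.trans hk1)
      rw [Real.dist_eq, abs_sub_comm] at h6
      have h7 : |f s| * (z t - z s) ≤ (C + 1) * (τ / (3 * (C + 1))) :=
        (mul_le_mul_of_nonneg_left ((le_abs_self _).trans h6.le) (abs_nonneg _)).trans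
          (mul_le_mul_of_nonneg_right ((hC s).trans (by linarith)) hτ'.le)
      have h8 : (C + 1) * (τ / (3 * (C + 1))) = τ / 3 := by field_simp
      linarith
    linarith [(hclose k t).1]

lemma IsGenerator.tendsto_integral_inf' {Ω : Type*} [MeasurableSpace Ω] {Z : Ω → C(S, ℝ)}
    {P : Measure Ω} (hZ : IsGenerator Z P) (hC : ∀ s, |f s| ≤ C) (hT : ∀ k, (T k).Nonempty)
    (hε : Tendsto ε atTop (𝓝 0)) (hε1 : ∀ k, ε k ≤ 1)
    (hnet : ∀ k s, ∃ t ∈ T k, dist s t < ε k ∧ |f s - f t| < ε k)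
    (hh : ∀ k s, |h k s - f s| ≤ 2 * ε k) :
    Tendsto (fun k => ∫ ω, (T k).inf' (hT k) (fun t => |h k t| * Z ω t) ∂P) atTop
      (𝓝 (dualDNorm Z P f)) := by
  refine tendsto_integral_of_dominated_convergence (fun ω => (C + 2) * ⨆ s, Z ω s)
    (fun k => (hZ.integrable_inf' (hT k) (h k)).aestronglyMeasurable) (hZ.2.2.2.const_mul _)
    (fun k => .of_forall fun ω => ?_)
    (.of_forall fun ω => tendsto_inf'_abs_mul hC hT hε hnet hh (hZ.2.1 ω))
  obtain ⟨t, -, ht⟩ := Finset.exists_mem_eq_inf' (hT k) fun t => |h k t| * Z ω t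
  rw [ht, Real.norm_of_nonneg (mul_nonneg (abs_nonneg _) (hZ.2.1 ω t))]
  have h1 := abs_sub_abs_le_abs_sub (h k t) (f t)
  exact mul_le_mul (by linarith [hh k t, hC t, hε1 k]) (le_ciSup (bddAbove_range_coe _) t)
    (hZ.2.1 ω t) (by linarith [(abs_nonneg _).trans (hC t)])

end Nets

/-! ### Moduli of continuity. -/

section Increments

variable {S : Type*} [MetricSpace S]

/-- The functions which, after truncation from below at `-C`, have an increment greater than `ε`
over a distance less than `δ`. -/
def largeTruncatedIncrement (S : Type*) [PseudoMetricSpace S] (C δ ε : ℝ) : Set C(S, ℝ) :=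
  {g | ∃ s t, dist s t < δ ∧ ε < max (g s) (-C) - max (g t) (-C)}

lemma isOpen_largeTruncatedIncrement (C δ ε : ℝ) :
    IsOpen (largeTruncatedIncrement S C δ ε) := by
  simp only [largeTruncatedIncrement, Set.ofPred_exists]
  refine isOpen_iUnion fun s => isOpen_iUnion fun t => ?_
  have h1 : Continuous fun g : C(S, ℝ) => max (g s) (-C) - max (g t) (-C) :=
    ((continuous_eval_const s).max continuous_const).sub
      ((continuous_eval_const t).max continuous_const)
  exact isOpen_const.and (isOpen_lt continuous_const h1)

lemma isOpen_largeIncrement (δ ε : ℝ) : IsOpen (largeIncrement S δ ε) := by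
  simp only [largeIncrement, Set.ofPred_exists]
  refine isOpen_iUnion fun s => isOpen_iUnion fun t => ?_
  exact isOpen_const.and (isOpen_lt continuous_const
    ((continuous_eval_const s).sub (continuous_eval_const t)))

variable [CompactSpace S]

/-- The portmanteau bound needs a closed set. A uniform perturbation by `ε / 4` changes an increment
by at most `ε / 2`. -/
lemma closure_largeIncrement_subset {δ ε : ℝ} (hε : 0 < ε) :
    closure (largeIncrement S δ ε) ⊆ largeIncrement S δ (ε / 2) := by
  intro g hg
  obtain ⟨g', ⟨s, t, hst, h⟩, hd⟩ := Metric.mem_closure_iff.1 hg (ε / 4) (by positivity)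
  have h1 : ∀ u, |g u - g' u| ≤ ε / 4 := fun u =>
    (ContinuousMap.dist_le (by positivity)).1 hd.le u
  exact ⟨s, t, hst, by linarith [(abs_le.1 (h1 s)).1, (abs_le.1 (h1 t)).2]⟩

/-- Each path is uniformly continuous, so the events decrease to the empty set as `δ → 0`. -/
lemma exists_measureReal_largeIncrement_lt {Ω : Type*} [MeasurableSpace Ω] {Q : Measure Ω}
    [IsProbabilityMeasure Q] {η : Ω → C(S, ℝ)} (hη : Measurable η) {ε ρ : ℝ} (hε : 0 < ε)
    (hρ : 0 < ρ) {d : ℝ} (hd : 0 < d) :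
    ∃ δ, 0 < δ ∧ δ ≤ d ∧ Q.real (η ⁻¹' largeIncrement S δ ε) < ρ := by
  set A : ℕ → Set Ω := fun k => η ⁻¹' largeIncrement S (1 / ((k : ℝ) + 1)) ε with hA
  have hanti : Antitone A := by
    rintro k l hkl ω ⟨s, t, hst, h⟩
    exact ⟨s, t, hst.trans_le (one_div_le_one_div_of_le (by positivity) (by gcongr)), h⟩
  have hempty : ⋂ k, A k = ∅ := by
    refine Set.eq_empty_of_forall_notMem fun ω hω => ?_
    obtain ⟨δ, hδ, huc⟩ := Metric.uniformContinuous_iff.1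
      (CompactSpace.uniformContinuous_of_continuous (η ω).continuous) ε hε
    obtain ⟨k, hk⟩ := exists_nat_one_div_lt hδ
    obtain ⟨s, t, hst, h⟩ := Set.mem_iInter.1 hω k
    have h1 := huc (hst.trans hk)
    rw [Real.dist_eq] at h1
    exact h.not_ge ((le_abs_self _).trans h1.le)
  have hlim := tendsto_measure_iInter_atTop (μ := Q)
    (fun k => (hη (isOpen_largeIncrement _ _).measurableSet).nullMeasurableSet) hanti
    ⟨0, measure_ne_top Q (A 0)⟩
  rw [hempty, measure_empty] at hlim
  have hlim' := (ENNReal.tendsto_toReal ENNReal.zero_ne_top).comp hlim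
  have hev := hlim'.eventually_lt_const (by simpa using hρ)
  obtain ⟨k, hk1, hk2⟩ := (hev.and
    (tendsto_one_div_add_atTop_nhds_zero_nat.eventually_lt_const hd)).exists
  exact ⟨1 / ((k : ℝ) + 1), by positivity, hk2.le, hk1⟩

end Increments

section SingleLargeTerm

variable {Ω : Type*} [MeasurableSpace Ω] {P : Measure Ω} [IsProbabilityMeasure P]

/-- The probability that exactly one of `n + 1` independent points lies in `A`, and the others
in `L`. -/
lemma mul_measureReal_mul_pow_le {A L : Set Ω} (hA : MeasurableSet A) (hL : MeasurableSet L)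
    (hd : Disjoint A L) (n : ℕ) {E : Set (ℕ → Ω)}
    (hE : ∀ ω : ℕ → Ω, ∀ i ∈ Finset.range (n + 1), ω i ∈ A →
      (∀ j ∈ Finset.range (n + 1), j ≠ i → ω j ∈ L) → ω ∈ E) :
    ((n : ℝ) + 1) * P.real A * P.real L ^ n ≤ (Measure.infinitePi fun _ : ℕ => P).real E := by
  -- Boxes with the exceptional point at index `i`; they are pairwise disjoint because `A` and `L`
  -- are.
  set B : ℕ → Set (ℕ → Ω) := fun i =>
    Set.pi (Finset.range (n + 1)) (Function.update (fun _ => L) i A) with hB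
  have hm : ∀ i j, MeasurableSet (Function.update (fun _ : ℕ => L) i A j) := by
    intro i j
    by_cases h : j = i
    · subst h; simpa using hA
    · simpa [h] using hL
  have hBA : ∀ i ∈ Finset.range (n + 1), ∀ ω ∈ B i, ω i ∈ A := fun i hi ω hω => by
    simpa using hω i hi
  have hBL : ∀ i, ∀ ω ∈ B i, ∀ j ∈ Finset.range (n + 1), j ≠ i → ω j ∈ L :=
    fun i ω hω j hj hji => by simpa [hji] using hω j hj
  have hdisj : (Finset.range (n + 1) : Set ℕ).PairwiseDisjoint B := by
    intro i hi j hj hij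
    refine Set.disjoint_left.2 fun ω h1 h2 => ?_
    exact Set.disjoint_left.1 hd (hBA i hi ω h1) (hBL j ω h2 i hi hij)
  have hmeas : ∀ i ∈ Finset.range (n + 1),
      (Measure.infinitePi fun _ : ℕ => P).real (B i) = P.real A * P.real L ^ n := by
    intro i hi
    rw [measureReal_infinitePi_pi fun j _ => hm i j, ← Finset.mul_prod_erase _ _ hi,
      Function.update_self, Finset.prod_congr rfl fun j hj => by
        rw [Function.update_of_ne (Finset.ne_of_mem_erase hj)]]
    simp [Finset.card_erase_of_mem hi]
  have hsub : (⋃ i ∈ Finset.range (n + 1), B i) ⊆ E := by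
    refine Set.iUnion₂_subset fun i hi ω hω => hE ω i hi (hBA i hi ω hω) (hBL i ω hω)
  refine le_trans (le_of_eq ?_) (measureReal_mono hsub)
  rw [measureReal_biUnion_finset hdisj fun i _ =>
    MeasurableSet.pi (Finset.countable_toSet _) fun j _ => hm i j, Finset.sum_congr rfl hmeas]
  simp [mul_assoc]

end SingleLargeTerm

/-! ### Pathwise consequences of large increments. -/

section Paths

variable {S : Type*} [MetricSpace S] {Ω : Type*} {f : S → ℝ}

/-- The maximum lies between `X (ω i)` and its truncation at `-C`. The two agree at the upper end
`s` of the increment, which must lie above `-C` because `ε > 0`. -/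
lemma iidMax_mem_largeIncrement {X : Ω → C(S, ℝ)} {n i : ℕ} {ω : ℕ → Ω} {C δ ε : ℝ}
    (hε : 0 < ε) (hi : i ∈ Finset.range (n + 1)) (hX : X (ω i) ∈ largeTruncatedIncrement S C δ ε)
    (hL : ∀ j ∈ Finset.range (n + 1), j ≠ i → ∀ s, X (ω j) s ≤ -C) :
    iidMax X n ω ∈ largeIncrement S δ ε := by
  obtain ⟨s, t, hst, h⟩ := hX
  have h1 : iidMax X n ω t ≤ max (X (ω i) t) (-C) := by
    refine iidMax_le_iff.2 fun j hj => ?_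
    by_cases hji : j = i
    · subst hji; exact le_max_left _ _
    · exact (hL j hj hji t).trans (le_max_right _ _)
  have h2 := le_iidMax (X := X) hi ω s
  have h3 : max (X (ω i) s) (-C) = X (ω i) s := by
    refine max_eq_left (le_of_not_gt fun hlt => ?_)
    rw [max_eq_right hlt.le] at h
    linarith [le_max_right (X (ω i) t) (-C)]
  exact ⟨s, t, hst, by linarith⟩

/-- If `x s ≤ f s`, a net point `t` near `s` has `x t > f t + 2 * ε > f s + ε`. Truncating `x s` is
harmless because `f ≥ -C`. -/
lemma forall_gt_or_mem_largeTruncatedIncrement {T : Finset S} {C δ ε : ℝ} (hδε : δ ≤ ε)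
    (hC : ∀ s, |f s| ≤ C) (hnet : ∀ s, ∃ t ∈ T, dist s t < δ ∧ |f s - f t| < δ) {x : C(S, ℝ)}
    (hx : ∀ s, x s ≤ 0) (h : ∀ t ∈ T, min (f t + 2 * ε) 0 < x t) :
    (∀ s, f s < x s) ∨ x ∈ largeTruncatedIncrement S C δ ε := by
  refine or_iff_not_imp_left.2 fun hn => ?_
  obtain ⟨s, hs⟩ := not_forall.1 hn
  obtain ⟨t, htT, hst, hf⟩ := hnet s
  have h1 : f t + 2 * ε < x t := (min_lt_iff.1 (h t htT)).resolve_right (hx t).not_gt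
  refine ⟨t, s, by rwa [dist_comm], ?_⟩
  have h2 : max (x s) (-C) ≤ f s := max_le (not_lt.1 hs) (abs_le.1 (hC s)).1
  linarith [le_max_left (x t) (-C), (abs_lt.1 hf).2]

end Paths

/-! ### The limit for the dual `D`-norm. -/

section DualNorm

variable {S : Type*} [MetricSpace S] [CompactSpace S] [Nonempty S]
  {Ω₁ Ω₂ Ω₃ : Type*} [MeasurableSpace Ω₁] [MeasurableSpace Ω₂] [MeasurableSpace Ω₃]
  {P₁ : Measure Ω₁} [IsProbabilityMeasure P₁] {P₂ : Measure Ω₂} [IsProbabilityMeasure P₂]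
  {P₃ : Measure Ω₃} {U : Ω₁ → C(S, ℝ)} {η : Ω₂ → C(S, ℝ)} {Z : Ω₃ → C(S, ℝ)} {f h : S → ℝ}

/-- For a sample path exceeding `h` on a nonempty set, large increments above the level `-C`
are unlikely. -/
lemma eventually_mul_measureReal_largeTruncatedIncrement_lt (hU : Measurable U)
    (hη : Measurable η) (hUη : InMaxDomain U P₁ η P₂) (hZ : IsGeneratorOf Z P₃ η P₂)
    {T : Finset S} (hT : T.Nonempty) {C δ ε r : ℝ} (hC : 0 ≤ C) (hh : ∀ s, -C ≤ h s)
    (hε : 0 < ε) (hr : P₂.real (η ⁻¹' largeIncrement S δ (ε / 2)) < r) :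
    ∀ᶠ n : ℕ in atTop, ((n : ℝ) + 1) * P₁.real {ω | (∀ t ∈ T, h t < rescale U n ω t) ∧
      rescale U n ω ∈ largeTruncatedIncrement S C δ ε} <
        2 * Real.exp (dNorm Z P₃ fun _ => -C) * r := by
  have hc : (fun _ : S => -C) ∈ FunENeg S := const_mem_FunENeg (by linarith)
  have h1 := tendsto_pow_measureReal_rescale_le hU hη hUη hZ hc
  set κ := Real.exp (-dNorm Z P₃ fun _ => -C) with hκ
  have hκ0 : 0 < κ := Real.exp_pos _
  have h2 := eventually_measureReal_preimage_lt hUη.tendsto_iidMax_rescale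
    (isClosed_closure (s := largeIncrement S δ ε))
    ((measureReal_mono (Set.preimage_mono (closure_largeIncrement_subset hε))).trans_lt hr)
  filter_upwards [h1.eventually_const_lt (half_lt_self hκ0), h2] with n hn1 hn2
  set L := {ω | ∀ s, rescale U n ω s ≤ -C} with hL
  set B := {ω | (∀ t ∈ T, h t < rescale U n ω t) ∧
    rescale U n ω ∈ largeTruncatedIncrement S C δ ε} with hB
  have hLm : MeasurableSet L :=
    measurable_rescale hU n (isClosed_setOf_forall_le fun _ => -C).measurableSet
  have hBm : MeasurableSet B := by
    have h3 : B = (⋂ t ∈ T, rescale U n ⁻¹' {g | h t < g t}) ∩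
        rescale U n ⁻¹' largeTruncatedIncrement S C δ ε := by
      ext ω; simp [hB]
    rw [h3]
    exact (T.measurableSet_biInter fun t _ =>
      measurable_rescale hU n (measurableSet_eval_lt t (h t))).inter
      (measurable_rescale hU n (isOpen_largeTruncatedIncrement C δ ε).measurableSet)
  have hdisj : Disjoint B L := by
    refine Set.disjoint_left.2 fun ω h1 h2 => ?_
    obtain ⟨t, ht⟩ := hT
    exact ((hh t).trans_lt (h1.1 t ht)).not_ge (h2 t)
  have h4 := mul_measureReal_mul_pow_le (P := P₁) hBm hLm hdisj n
    (E := iidMax (rescale U n) n ⁻¹' closure (largeIncrement S δ ε))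
    fun ω i hi hA hj => subset_closure (iidMax_mem_largeIncrement hε hi hA.2 hj)
  -- Only the `n` copies other than the exceptional one must stay below `-C`, hence the exponent `n`
  -- in place of `n + 1`.
  have h5 : κ / 2 < P₁.real L ^ n :=
    hn1.trans_le (pow_le_pow_of_le_one measureReal_nonneg measureReal_le_one n.le_succ)
  have h6 : ((n : ℝ) + 1) * P₁.real B * (κ / 2) < r :=
    ((mul_le_mul_of_nonneg_left h5.le (by positivity)).trans h4).trans_lt hn2
  have h7 : Real.exp (dNorm Z P₃ fun _ => -C) = κ⁻¹ := by rw [hκ, Real.exp_neg, inv_inv]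
  rw [h7]
  calc ((n : ℝ) + 1) * P₁.real B = ((n : ℝ) + 1) * P₁.real B * (κ / 2) * (2 * κ⁻¹) := by
        field_simp
    _ < r * (2 * κ⁻¹) := mul_lt_mul_of_pos_right h6 (by positivity)
    _ = _ := mul_comm _ _

lemma tendsto_forall_rescale_gt (hU : IsCopulaProcess U P₁) (hη : Measurable η)
    (hUη : InMaxDomain U P₁ η P₂) (hZ : IsGeneratorOf Z P₃ η P₂) (hf : f ∈ FunENeg S) :
    Tendsto (fun n : ℕ => ((n : ℝ) + 1) * P₁.real {ω | ∀ s, f s < rescale U n ω s}) atTop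
      (𝓝 (dualDNorm Z P₃ f)) := by
  obtain ⟨⟨⟨C, hC⟩, -⟩, hf0⟩ := hf
  have hC0 : 0 ≤ C := (abs_nonneg _).trans (hC (Classical.arbitrary S))
  set ε : ℕ → ℝ := fun k => 1 / ((k : ℝ) + 1) with hεdef
  have hε0 : ∀ k, 0 < ε k := fun k => by positivity
  have hε1 : ∀ k, ε k ≤ 1 := fun k => by
    simp only [hεdef]
    exact (div_le_one (by positivity)).2 (by linarith [(Nat.cast_nonneg k : (0 : ℝ) ≤ k)])
  have hε : Tendsto ε atTop (𝓝 0) := tendsto_one_div_add_atTop_nhds_zero_nat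
  -- One scale `δ k` serves both as mesh of the net and as increment distance; the probability bound
  -- `ε k` makes the final error `K * ε k`.
  choose δ hδ0 hδε hδ using fun k => exists_measureReal_largeIncrement_lt (Q := P₂) hη
    (half_pos (hε0 k)) (hε0 k) (hε0 k)
  choose T hT hnet using fun k => exists_finset_graph_net hC (hδ0 k)
  have hnet' : ∀ k s, ∃ t ∈ T k, dist s t < ε k ∧ |f s - f t| < ε k := fun k s => by
    obtain ⟨t, ht, h1, h2⟩ := hnet k s
    exact ⟨t, ht, h1.trans_le (hδε k), h2.trans_le (hδε k)⟩
  -- Capped at `0` because the finite-dimensional limit requires a nonpositive threshold.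
  set h : ℕ → S → ℝ := fun k s => min (f s + 2 * ε k) 0 with hhdef
  have hh : ∀ k s, |h k s - f s| ≤ 2 * ε k := fun k s => by
    have h1 : f s ≤ h k s := le_min (by linarith [hε0 k]) (hf0 s)
    have h2 : h k s ≤ f s + 2 * ε k := min_le_left _ _
    rw [abs_of_nonneg (by linarith)]
    linarith
  have hhC : ∀ k s, -C ≤ h k s := fun k s =>
    le_min (by linarith [(abs_le.1 (hC s)).1, hε0 k]) (by linarith)
  have hI := hZ.1.tendsto_integral_inf' hC hT hε hε1 hnet' hh
  have hJ := hZ.1.tendsto_integral_inf' (h := fun _ => f) hC hT hε hε1 hnet'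
    (fun k s => by simpa using (hε0 k).le)
  set K := 2 * Real.exp (dNorm Z P₃ fun _ => -C) with hK
  refine tendsto_order.2 ⟨fun a ha => ?_, fun a ha => ?_⟩
  · have hI' := hI.sub (hε.const_mul K)
    rw [mul_zero, sub_zero] at hI'
    obtain ⟨k, hk⟩ := (hI'.eventually_const_lt ha).exists
    have h1 := tendsto_forall_mem_rescale_gt hU hη hUη hZ (h := h k)
      (fun s => min_le_right _ _) (hT k)
    have h2 := eventually_mul_measureReal_largeTruncatedIncrement_lt hU.1 hη hUη hZ (hT k) hC0
      (hhC k) (hε0 k) (hδ k)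
    filter_upwards [h1.eventually_const_lt (lt_sub_iff_add_lt.1 hk), h2] with n hn1 hn2
    have h3 : P₁.real {ω | ∀ t ∈ T k, h k t < rescale U n ω t} ≤
        P₁.real {ω | ∀ s, f s < rescale U n ω s} +
        P₁.real {ω | (∀ t ∈ T k, h k t < rescale U n ω t) ∧
          rescale U n ω ∈ largeTruncatedIncrement S C (δ k) (ε k)} := by
      refine le_trans ?_ (measureReal_union_le _ _)
      refine ENNReal.toReal_mono (measure_ne_top _ _) (measure_mono_ae ?_)
      filter_upwards [hU.ae_le_one] with ω hω hωT
      exact (forall_gt_or_mem_largeTruncatedIncrement (hδε k) hC (hnet k) (rescale_nonpos hω)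
        hωT).imp_right fun h => ⟨hωT, h⟩
    have h4 := mul_le_mul_of_nonneg_left h3 (by positivity : (0 : ℝ) ≤ (n : ℝ) + 1)
    linarith
  -- For the upper bound, restricting the condition to the net suffices, with `f` itself as
  -- threshold.
  · obtain ⟨k, hk⟩ := (hJ.eventually_lt_const ha).exists
    have h1 := tendsto_forall_mem_rescale_gt hU hη hUη hZ (h := f) hf0 (hT k)
    filter_upwards [h1.eventually_lt_const hk] with n hn
    have h2 : {ω | ∀ s, f s < rescale U n ω s} ⊆ {ω | ∀ t ∈ T k, f t < rescale U n ω t} :=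
      fun ω h t _ => h t
    exact (mul_le_mul_of_nonneg_left (measureReal_mono h2) (by positivity)).trans_lt hn

end DualNorm

end FunctionalRecords

theorem mainTheorem2 {S : Type*} [MetricSpace S] [CompactSpace S] [Nonempty S]
    {Ω₁ Ω₂ Ω₃ : Type*} [MeasurableSpace Ω₁] [MeasurableSpace Ω₂] [MeasurableSpace Ω₃]
    (P₁ : Measure Ω₁) [IsProbabilityMeasure P₁]
    (P₂ : Measure Ω₂) [IsProbabilityMeasure P₂]
    (P₃ : Measure Ω₃) [IsProbabilityMeasure P₃]
    (U : Ω₁ → C(S, ℝ)) (η : Ω₂ → C(S, ℝ)) (Z : Ω₃ → C(S, ℝ))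
    (hU : FunctionalRecords.IsCopulaProcess U P₁)
    (hη : FunctionalRecords.IsStandardMaxStable η P₂)
    (hUη : FunctionalRecords.InMaxDomain U P₁ η P₂)
    (hZ : FunctionalRecords.IsGeneratorOf Z P₃ η P₂) :
    ∀ f ∈ FunctionalRecords.FunENeg S,
      Tendsto (fun n : ℕ => (n : ℝ) * (1 - P₁.real {ω | ∀ s, (n : ℝ) * (U ω s - 1) ≤ f s}))
        atTop (𝓝 (FunctionalRecords.dNorm Z P₃ f)) ∧
      Tendsto (fun n : ℕ => (n : ℝ) * P₁.real {ω | ∀ s, f s < (n : ℝ) * (U ω s - 1)})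
        atTop (𝓝 (FunctionalRecords.dualDNorm Z P₃ f)) := by
  intro f hf
  have hηm : Measurable η := hη.1.1
  constructor
  -- `rescale U n` carries the factor `n + 1`.
  · rw [← tendsto_add_atTop_iff_nat 1]
    refine (FunctionalRecords.tendsto_exists_rescale_gt hU.1 hηm hUη hZ hf).congr fun n => ?_
    have hm : MeasurableSet {ω | ∀ s, FunctionalRecords.rescale U n ω s ≤ f s} :=
      FunctionalRecords.measurable_rescale hU.1 n
        (FunctionalRecords.isClosed_setOf_forall_le f).measurableSet
    have h := probReal_compl_eq_one_sub (μ := P₁) hm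
    simp only [Set.compl_ofPred, not_forall, not_le, FunctionalRecords.rescale_apply] at h
    simp only [FunctionalRecords.rescale_apply, Nat.cast_add, Nat.cast_one, h]
  · rw [← tendsto_add_atTop_iff_nat 1]
    refine (FunctionalRecords.tendsto_forall_rescale_gt hU hηm hUη hZ hf).congr fun n => ?_
    simp only [FunctionalRecords.rescale_apply, Nat.cast_add, Nat.cast_one]
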